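/- **Lemma 3.1.** Let $X$ be a CAT(0) space and let $A$, $B$, $C$ be closed subsets of $X$ such that $C$ separates $A$ and $B$ in $X$, i.e. every path in $X$ from a point of $A$ to a point of $B$ meets $C$. Fix a basepoint $q\in X$. Let $\partial X=\partial_qX$ be the visual boundary of $X$, that is, the set of geodesic rays $c:[0,\infty)\to X$ with $c(0)=q$. Give $X\cup\partial X$ the cone topology, generated by the open balls of $X$ and the sets $$U(c,r,D)=\{x\in X\cup\partial X:\ d(x,q)>r,\ d(\pi_r(x),c(r))<D\},\qquad r,D>0,$$ where $c$ is a geodesic segment or ray from $q$ that is defined at $r$, and $\pi_r$ is the projection to the closed ball of radius $r$ about $q$ (for a ray $\xi\in\partial X$ one puts $d(\xi,q)=\infty$ and $\pi_r(\xi)=\xi(r)$); give $\partial X$ the subspace topology. For $S\subseteq X$ let the limit set $\Lambda(S)$ be the set of points of $\partial X$ that lie in the closure of $S$ in $X\cup\partial X$. Then every path in $\partial X$ from a point of $\Lambda(A)$ to a point of $\Lambda(B)$ passes through a point of $\Lambda(C)$; that is, $\Lambda(C)$ separates $\Lambda(A)$ and $\Lambda(B)$ in $\partial X$. -/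

import Mathlib

open scoped NNReal

/-- A geodesic segment from `x` to `y`, parametrized by arc length on `[0, dist x y]`. -/
def IsGeodesicSegment {X : Type*} [MetricSpace X] (c : ℝ → X) (x y : X) : Prop :=
  c 0 = x ∧ c (dist x y) = y ∧
    ∀ s ∈ Set.Icc 0 (dist x y), ∀ t ∈ Set.Icc 0 (dist x y), dist (c s) (c t) = |s - t|

/-- `x` lies on a geodesic segment from `p` to `q`. -/
def OnGeodesic {X : Type*} [MetricSpace X] (p q x : X) : Prop :=
  ∃ c : ℝ → X, IsGeodesicSegment c p q ∧ ∃ t ∈ Set.Icc 0 (dist p q), c t = x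

/-- A CAT(0) space: a geodesic metric space in which geodesic triangles are no fatter than
their comparison triangles in the Euclidean plane.  Here `p, q, r` are the vertices of the
triangle, `x` and `y` are points on two of its sides (named so that these sides share the
vertex `p`), `p', q', r'` is a comparison triangle and `x', y'` are the comparison points. -/
structure IsCAT0 (X : Type*) [MetricSpace X] : Prop where
  exists_geodesic : ∀ x y : X, ∃ c : ℝ → X, IsGeodesicSegment c x y
  comparison : ∀ p q r x y : X, OnGeodesic p q x → OnGeodesic p r y →
    ∀ p' q' r' x' y' : EuclideanSpace ℝ (Fin 2),
      dist p' q' = dist p q → dist p' r' = dist p r → dist q' r' = dist q r →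
      dist p' x' = dist p x → dist x' q' = dist x q →
      dist p' y' = dist p y → dist y' r' = dist y r →
      dist x y ≤ dist x' y'

/-- The visual boundary `∂_q X` as a set: the geodesic rays `[0, ∞) → X` based at `q`. -/
structure VisualBoundary {X : Type*} [MetricSpace X] (q : X) where
  ray : ℝ≥0 → X
  isometry_ray : Isometry ray
  ray_zero : ray 0 = q

/-- The bordification `X ∪ ∂_q X` as a set. -/
inductive Bordification {X : Type*} [MetricSpace X] (q : X) where
  | point (x : X) : Bordification q
  | ideal (ξ : VisualBoundary q) : Bordification q

/-- `p` is the projection (the nearest point) of `x` in the closed ball of radius `r` about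
`q`. -/
def IsBallProjection {X : Type*} [MetricSpace X] (q : X) (r : ℝ) (x p : X) : Prop :=
  p ∈ Metric.closedBall q r ∧ ∀ z ∈ Metric.closedBall q r, dist x p ≤ dist x z

/-- The set `U(c, r, D)` of all points of `X ∪ ∂_q X` that are farther than `r` from `q` and
whose projection to the closed ball of radius `r` about `q` is within `D` of `y = c(r)`.  The
points of `∂_q X` are infinitely far from `q`, and the projection of a ray `ξ` is `ξ(r)`. -/
def coneNbhd {X : Type*} [MetricSpace X] (q : X) (y : X) (r : ℝ≥0) (D : ℝ) :
    Set (Bordification q) :=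
  {z | match z with
    | .point x => (r : ℝ) < dist x q ∧ ∃ p, IsBallProjection q r x p ∧ dist p y < D
    | .ideal ξ => dist (ξ.ray r) y < D}

/-- The cone topology on `X ∪ ∂_q X`, generated by the open balls of `X` and the sets
`U(c, r, D)` with `r, D > 0` and `c` a geodesic segment or ray from `q` that is defined at `r`.
In a geodesic space the points `y = c(r)` are exactly the points with `dist q y = r`. -/
instance {X : Type*} [MetricSpace X] (q : X) : TopologicalSpace (Bordification q) :=
  TopologicalSpace.generateFrom
    ({V | ∃ (x : X) (ε : ℝ), 0 < ε ∧ V = Bordification.point '' Metric.ball x ε} ∪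
     {V | ∃ (y : X) (r : ℝ≥0) (D : ℝ), 0 < r ∧ 0 < D ∧ dist q y = r ∧ V = coneNbhd q y r D})

/-- The cone topology on `∂_q X`: the subspace topology from `X ∪ ∂_q X`. -/
instance {X : Type*} [MetricSpace X] (q : X) : TopologicalSpace (VisualBoundary q) :=
  TopologicalSpace.induced Bordification.ideal inferInstance

/-- The limit set `Λ(A)` in `∂_q X`: the boundary points in the closure of `A` in
`X ∪ ∂_q X`. -/
def limitSet {X : Type*} [MetricSpace X] (q : X) (A : Set X) : Set (VisualBoundary q) :=
  {ξ | Bordification.ideal ξ ∈ closure (Bordification.point '' A : Set (Bordification q))}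

/-- `C` separates `A` and `B` in `Y`: every path in `Y` from a point of `A` to a point of `B`
passes through `C`. -/
def Separates {Y : Type*} [TopologicalSpace Y] (C A B : Set Y) : Prop :=
  ∀ a ∈ A, ∀ b ∈ B, ∀ γ : Path a b, ∃ t, γ t ∈ C

open Set Filter Topology

/-! ### Radial points and geodesics. -/

section CAT0

variable {X : Type*} [MetricSpace X]

/-! Suppose a path at infinity avoids `Λ(C)`. By compactness a single pair `r`, `D` makes every
`U(γ(t), r, D)` miss `C` (`exists_uniform_coneNbhd`). Pushing the path down to the sphere of radius
`r + D` gives a path in `X` inside the union `W` of these sets. Its ends can be joined within `W` to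
points of `A` and `B` (`joinedIn_coneNbhd`), so `A` and `B` are connected by a path missing `C`, a
contradiction. CAT(0) enters through the nonexpansion of radial retraction
(`IsCAT0.dist_radial_le`). -/

/-- `m` is the point at distance `r` from `q` on some geodesic from `q` to `x`. -/
def IsRadialPoint (q : X) (r : ℝ) (x m : X) : Prop :=
  dist q m = r ∧ dist q m + dist m x = dist q x

theorem IsRadialPoint.trans {q x p m : X} {r s : ℝ} (h : IsRadialPoint q r p m)
    (h' : IsRadialPoint q s x p) : IsRadialPoint q r x m := by
  obtain ⟨h1, h2⟩ := h
  obtain ⟨h3, h4⟩ := h'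
  refine ⟨h1, le_antisymm ?_ (dist_triangle _ _ _)⟩
  linarith [dist_triangle m p x]

theorem isBallProjection_iff (hX : IsCAT0 X) {q x p : X} {r : ℝ} (hr : 0 ≤ r)
    (hx : r < dist x q) : IsBallProjection q r x p ↔ IsRadialPoint q r x p := by
  unfold IsBallProjection IsRadialPoint
  rw [Metric.mem_closedBall]
  constructor
  · rintro ⟨h1, h2⟩
    obtain ⟨c, hc0, hc1, hc⟩ := hX.exists_geodesic q x
    have hx' : r < dist q x := by rwa [dist_comm]
    have hr' : r ∈ Icc 0 (dist q x) := ⟨hr, hx'.le⟩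
    have h0 : (0 : ℝ) ∈ Icc 0 (dist q x) := ⟨le_rfl, dist_nonneg⟩
    have hl : dist q x ∈ Icc 0 (dist q x) := ⟨dist_nonneg, le_rfl⟩
    have e1 := hc r hr' 0 h0
    have e2 := hc (dist q x) hl r hr'
    rw [hc0, sub_zero, abs_of_nonneg hr] at e1
    rw [hc1, abs_of_pos (by linarith)] at e2
    have h3 := h2 (c r) (by rw [Metric.mem_closedBall, e1])
    have h4 := dist_triangle q p x
    rw [dist_comm q p, dist_comm p x] at *
    constructor <;> linarith
  · rintro ⟨h1, h2⟩
    refine ⟨by rw [dist_comm, h1], fun z hz => ?_⟩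
    rw [Metric.mem_closedBall] at hz
    have := dist_triangle q z x
    rw [dist_comm q z] at this
    rw [dist_comm x p, dist_comm x z]
    linarith

theorem IsCAT0.exists_isRadialPoint (hX : IsCAT0 X) {q x : X} {r : ℝ} (hr : 0 ≤ r)
    (hx : r ≤ dist q x) : ∃ m, IsRadialPoint q r x m := by
  obtain ⟨c, hc0, hc1, hc⟩ := hX.exists_geodesic q x
  have hr' : r ∈ Icc 0 (dist q x) := ⟨hr, hx⟩
  have e1 := hc 0 ⟨le_rfl, dist_nonneg⟩ r hr'
  have e2 := hc r hr' (dist q x) ⟨dist_nonneg, le_rfl⟩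
  rw [hc0, zero_sub, abs_neg, abs_of_nonneg hr] at e1
  rw [hc1, abs_sub_comm, abs_of_nonneg (by linarith)] at e2
  exact ⟨c r, e1, by rw [e1, e2]; ring⟩

/-- Geodesics from `p` to `m` and from `m` to `q` concatenate to a geodesic: a shortcut between the
two pieces would make `p` and `q` too close. -/
theorem IsCAT0.onGeodesic (hX : IsCAT0 X) {p q m : X}
    (h : dist p m + dist m q = dist p q) : OnGeodesic p q m := by
  obtain ⟨c, hc0, hc1, hc⟩ := hX.exists_geodesic p m
  obtain ⟨d, hd0, hd1, hd⟩ := hX.exists_geodesic m q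
  have hm : dist p m ∈ Icc 0 (dist p m) := ⟨dist_nonneg, le_rfl⟩
  have h0 : (0 : ℝ) ∈ Icc 0 (dist m q) := ⟨le_rfl, dist_nonneg⟩
  have key : ∀ s t : ℝ, 0 ≤ s → s ≤ dist p m → dist p m < t → t ≤ dist p q →
      dist (c s) (d (t - dist p m)) = t - s := by
    intro s t hs hs' ht ht'
    have htd : t - dist p m ∈ Icc 0 (dist m q) := ⟨by linarith, by linarith⟩
    have e1 := hc s ⟨hs, hs'⟩ _ hm
    have e2 := hd 0 h0 _ htd
    have e3 := hc 0 ⟨le_rfl, dist_nonneg⟩ s ⟨hs, hs'⟩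
    have e4 := hd _ htd (dist m q) ⟨dist_nonneg, le_rfl⟩
    rw [hc1, abs_sub_comm, abs_of_nonneg (by linarith)] at e1
    rw [hd0, abs_sub_comm, sub_zero, abs_of_nonneg htd.1] at e2
    rw [hc0, abs_sub_comm, sub_zero, abs_of_nonneg hs] at e3
    rw [hd1, abs_sub_comm, abs_of_nonneg (by linarith)] at e4
    apply le_antisymm
    · linarith [dist_triangle (c s) m (d (t - dist p m))]
    · linarith [dist_triangle4 p (c s) (d (t - dist p m)) q]
  refine ⟨fun t => if t ≤ dist p m then c t else d (t - dist p m), ⟨?_, ?_, ?_⟩,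
    dist p m, ⟨dist_nonneg, ?_⟩, ?_⟩
  · simp [hc0]
  · dsimp only
    split_ifs with hle
    · have : dist m q = 0 := le_antisymm (by linarith) dist_nonneg
      rw [← h, this, add_zero, hc1]
      exact dist_eq_zero.1 this
    · rw [← h, add_sub_cancel_left, hd1]
  · intro s hs t ht
    dsimp only
    split_ifs with h1 h2 h2
    · exact hc s ⟨hs.1, h1⟩ t ⟨ht.1, h2⟩
    · rw [key s t hs.1 h1 (not_le.1 h2) ht.2, abs_sub_comm, abs_of_nonneg (by linarith)]
    · rw [dist_comm, key t s ht.1 h2 (not_le.1 h1) hs.2, abs_of_nonneg (by linarith)]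
    · rw [hd _ ⟨by linarith, by linarith [hs.2]⟩ _ ⟨by linarith, by linarith [ht.2]⟩]
      congr 1
      ring
  · linarith [dist_nonneg (x := m) (y := q)]
  · simp [hc1]

/-! ### Nonexpansion of radial retraction. -/

/-- A Euclidean triangle with one vertex at the origin and prescribed side lengths. -/
theorem exists_euclidean_triangle {a b c : ℝ} (ha : 0 < a) (hb : 0 ≤ b) (h1 : c ≤ a + b)
    (h2 : a ≤ b + c) (h3 : b ≤ a + c) :
    ∃ v w : EuclideanSpace ℝ (Fin 2), ‖v‖ = a ∧ ‖w‖ = b ∧ ‖v - w‖ = c := by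
  have hc : 0 ≤ c := by linarith
  -- With `v` on the first axis, the law of cosines forces this first coordinate of `w`.
  set u := (a ^ 2 + b ^ 2 - c ^ 2) / (2 * a) with hu
  have hua : 2 * a * u = a ^ 2 + b ^ 2 - c ^ 2 := by rw [hu]; field_simp
  have hub : u ≤ b := by
    have : 2 * a * u ≤ 2 * a * b := by
      rw [hua]; nlinarith [mul_nonneg (by linarith : 0 ≤ c - a + b) (by linarith : 0 ≤ c + a - b)]
    exact le_of_mul_le_mul_left this (by linarith)
  have hbu : -b ≤ u := by
    have : 2 * a * (-b) ≤ 2 * a * u := by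
      rw [hua]; nlinarith [mul_nonneg (by linarith : 0 ≤ a + b - c) (by linarith : 0 ≤ a + b + c)]
    exact le_of_mul_le_mul_left this (by linarith)
  have hs : Real.sqrt (b ^ 2 - u ^ 2) ^ 2 = b ^ 2 - u ^ 2 :=
    Real.sq_sqrt (by nlinarith)
  refine ⟨!₂[a, 0], !₂[u, Real.sqrt (b ^ 2 - u ^ 2)], ?_, ?_, ?_⟩
  · rw [EuclideanSpace.norm_eq, Real.sqrt_eq_iff_mul_self_eq (by positivity) ha.le]
    simp [Fin.sum_univ_two, sq]
  · rw [EuclideanSpace.norm_eq, Real.sqrt_eq_iff_mul_self_eq (by positivity) hb]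
    simp only [Fin.sum_univ_two, Real.norm_eq_abs, sq_abs]
    simp
    linarith
  · rw [EuclideanSpace.norm_eq, Real.sqrt_eq_iff_mul_self_eq (by positivity) hc]
    simp only [Fin.sum_univ_two, Real.norm_eq_abs, sq_abs]
    simp
    nlinarith

/-- Radial retraction onto a ball is nonexpanding in an inner product space. -/
theorem norm_radial_sub_le {E : Type*} [NormedAddCommGroup E] [InnerProductSpace ℝ E]
    {v w : E} {r : ℝ} (hr : 0 < r) (hv : r ≤ ‖v‖) (hw : r ≤ ‖w‖) :
    ‖(r / ‖v‖) • v - (r / ‖w‖) • w‖ ≤ ‖v - w‖ := by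
  have hv0 : 0 < ‖v‖ := by linarith
  have hw0 : 0 < ‖w‖ := by linarith
  apply le_of_sq_le_sq _ (norm_nonneg _)
  rw [norm_sub_sq_real, norm_sub_sq_real, norm_smul, norm_smul, real_inner_smul_left,
    real_inner_smul_right, Real.norm_of_nonneg (by positivity), Real.norm_of_nonneg (by positivity),
    div_mul_cancel₀ _ hv0.ne', div_mul_cancel₀ _ hw0.ne']
  -- `k` is the cosine of the angle; the squares differ by `(‖v‖ - ‖w‖)² + 2(‖v‖‖w‖ - r²)(1 - k)`.
  set k := inner ℝ v w / (‖v‖ * ‖w‖) with hk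
  have hk1 : k ≤ 1 := by
    rw [hk, div_le_one (by positivity)]; exact real_inner_le_norm v w
  have e1 : inner ℝ v w = k * (‖v‖ * ‖w‖) := by rw [hk]; field_simp
  have e2 : r / ‖v‖ * (r / ‖w‖ * inner ℝ v w) = r * r * k := by rw [hk]; field_simp
  rw [e2, e1]
  have : r * r ≤ ‖v‖ * ‖w‖ := mul_le_mul hv hw hr.le hv0.le
  nlinarith [mul_nonneg (sub_nonneg.2 this) (sub_nonneg.2 hk1), sq_nonneg (‖v‖ - ‖w‖)]

/-- Radial retraction onto a ball is nonexpanding in a CAT(0) space. -/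
theorem IsCAT0.dist_radial_le (hX : IsCAT0 X) {q x y m n : X} {r : ℝ} (hr : 0 < r)
    (hm : IsRadialPoint q r x m) (hn : IsRadialPoint q r y n) : dist m n ≤ dist x y := by
  obtain ⟨hm1, hm2⟩ := hm
  obtain ⟨hn1, hn2⟩ := hn
  have hrx : r ≤ dist q x := by linarith [dist_nonneg (x := m) (y := x)]
  have hry : r ≤ dist q y := by linarith [dist_nonneg (x := n) (y := y)]
  obtain ⟨v, w, hv, hw, hvw⟩ := exists_euclidean_triangle (a := dist q x) (b := dist q y)
    (c := dist x y) (by linarith) dist_nonneg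
    (by linarith [dist_triangle x q y, dist_comm x q])
    (by linarith [dist_triangle q y x, dist_comm x y]) (dist_triangle _ _ _)
  have radial : ∀ {u : EuclideanSpace ℝ (Fin 2)}, r ≤ ‖u‖ →
      dist 0 ((r / ‖u‖) • u) = r ∧ dist ((r / ‖u‖) • u) u = ‖u‖ - r := by
    intro u hu
    have hu0 : 0 < ‖u‖ := by linarith
    constructor
    · rw [dist_zero_left, norm_smul, Real.norm_of_nonneg (by positivity),
        div_mul_cancel₀ _ hu0.ne']
    · have : (r / ‖u‖) • u - u = (r / ‖u‖ - 1) • u := by rw [sub_smul, one_smul]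
      rw [dist_eq_norm, this, norm_smul, Real.norm_eq_abs, abs_sub_comm,
        abs_of_nonneg (sub_nonneg.2 ((div_le_one hu0).2 hu)), sub_mul,
        div_mul_cancel₀ _ hu0.ne', one_mul]
  obtain ⟨v1, v2⟩ := radial (hrx.trans_eq hv.symm)
  obtain ⟨w1, w2⟩ := radial (hry.trans_eq hw.symm)
  refine (hX.comparison q x y m n (hX.onGeodesic hm2) (hX.onGeodesic hn2) 0 v w
    ((r / ‖v‖) • v) ((r / ‖w‖) • w) (by rw [dist_zero_left, hv]) (by rw [dist_zero_left, hw])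
    (by rw [dist_eq_norm, hvw]) (by rw [v1, hm1]) (by rw [v2, hv]; linarith)
    (by rw [w1, hn1]) (by rw [w2, hw]; linarith)).trans ?_
  rw [dist_eq_norm, ← hvw]
  exact norm_radial_sub_le hr (hrx.trans_eq hv.symm) (hry.trans_eq hw.symm)

/-! ### Cone neighbourhoods of boundary points. -/

namespace VisualBoundary

variable {q : X}

theorem dist_ray (ξ : VisualBoundary q) (r : ℝ≥0) : dist q (ξ.ray r) = r := by
  have h : dist q (ξ.ray r) = dist (ξ.ray 0) (ξ.ray r) :=
    congrArg (dist · (ξ.ray r)) ξ.ray_zero.symm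
  rw [h, ξ.isometry_ray.dist_eq, NNReal.dist_eq]
  simp

theorem isRadialPoint_ray (ξ : VisualBoundary q) {r s : ℝ≥0} (h : r ≤ s) :
    IsRadialPoint q r (ξ.ray s) (ξ.ray r) := by
  refine ⟨ξ.dist_ray r, ?_⟩
  have h' : (r : ℝ) ≤ s := h
  rw [ξ.dist_ray, ξ.dist_ray, ξ.isometry_ray.dist_eq, NNReal.dist_eq, abs_sub_comm,
    abs_of_nonneg (by linarith)]
  ring

end VisualBoundary

theorem point_mem_coneNbhd (hX : IsCAT0 X) {q x y : X} {r : ℝ≥0} {D : ℝ} :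
    Bordification.point x ∈ coneNbhd q y r D ↔
      (r : ℝ) < dist q x ∧ ∃ p, IsRadialPoint q r x p ∧ dist p y < D := by
  change ((r : ℝ) < dist x q ∧ ∃ p, IsBallProjection q r x p ∧ dist p y < D) ↔ _
  rw [dist_comm x q]
  refine and_congr_right fun h => exists_congr fun p => and_congr_left fun _ => ?_
  exact isBallProjection_iff hX r.coe_nonneg (by rwa [dist_comm])

theorem ideal_mem_coneNbhd {q y : X} {ξ : VisualBoundary q} {r : ℝ≥0} {D : ℝ} :
    Bordification.ideal ξ ∈ coneNbhd q y r D ↔ dist (ξ.ray r) y < D := Iff.rfl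

theorem isOpen_coneNbhd_ray {q : X} (ξ : VisualBoundary q) {r : ℝ≥0} {D : ℝ} (hr : 0 < r)
    (hD : 0 < D) : IsOpen (coneNbhd q (ξ.ray r) r D) :=
  TopologicalSpace.isOpen_generateFrom_of_mem
    (Or.inr ⟨ξ.ray r, r, D, hr, hD, ξ.dist_ray r, rfl⟩)

theorem coneNbhd_subset_of_dist {q y z : X} {r : ℝ≥0} {D E : ℝ} (h : E + dist y z ≤ D) :
    coneNbhd q y r E ⊆ coneNbhd q z r D := by
  rintro (x | ξ) hx
  · obtain ⟨h1, p, hp, hpy⟩ := hx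
    exact ⟨h1, p, hp, by linarith [dist_triangle p y z]⟩
  · rw [ideal_mem_coneNbhd] at hx ⊢
    linarith [dist_triangle (ξ.ray r) y z]

/-- Projection to radius `r` factors through projection to radius `s`, and the second stage is
nonexpanding. -/
theorem coneNbhd_ray_anti (hX : IsCAT0 X) {q : X} (ξ : VisualBoundary q) {r s : ℝ≥0} {D E : ℝ}
    (hr : 0 < r) (hrs : r ≤ s) (hED : E ≤ D) :
    coneNbhd q (ξ.ray s) s E ⊆ coneNbhd q (ξ.ray r) r D := by
  have hrs' : (r : ℝ) ≤ s := hrs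
  rintro (x | η) hx
  · rw [point_mem_coneNbhd hX] at hx ⊢
    obtain ⟨h1, p, hp, hpy⟩ := hx
    obtain ⟨m, hm⟩ := hX.exists_isRadialPoint (q := q) (x := p) r.coe_nonneg (by rw [hp.1]; exact hrs')
    refine ⟨hrs'.trans_lt h1, m, hm.trans hp, ?_⟩
    exact ((hX.dist_radial_le hr hm (ξ.isRadialPoint_ray hrs)).trans_lt hpy).trans_le hED
  · rw [ideal_mem_coneNbhd] at hx ⊢
    exact ((hX.dist_radial_le hr (η.isRadialPoint_ray hrs)
      (ξ.isRadialPoint_ray hrs)).trans_lt hx).trans_le hED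

/-- The sets `U(ξ, r, D)` form a neighbourhood basis at `ξ` in the cone topology. -/
theorem exists_coneNbhd_subset (hX : IsCAT0 X) {q : X} (ξ : VisualBoundary q)
    {V : Set (Bordification q)} (hV : IsOpen V) (hξ : Bordification.ideal ξ ∈ V) :
    ∃ (r : ℝ≥0) (D : ℝ), 0 < r ∧ 0 < D ∧ coneNbhd q (ξ.ray r) r D ⊆ V := by
  induction hV with
  | basic V hV =>
    rcases hV with ⟨x, ε, -, rfl⟩ | ⟨y, r, D, hr, -, -, rfl⟩
    · obtain ⟨_, _, h⟩ := hξ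
      cases h
    · rw [ideal_mem_coneNbhd] at hξ
      exact ⟨r, D - dist (ξ.ray r) y, hr, sub_pos.2 hξ, coneNbhd_subset_of_dist (by simp)⟩
  | univ => exact ⟨1, 1, one_pos, one_pos, subset_univ _⟩
  | inter V W _ _ ihV ihW =>
    obtain ⟨r, D, hr, hD, h⟩ := ihV hξ.1
    obtain ⟨s, E, hs, hE, h'⟩ := ihW hξ.2
    refine ⟨max r s, min D E, lt_max_of_lt_left hr, lt_min hD hE, subset_inter ?_ ?_⟩
    · exact (coneNbhd_ray_anti hX ξ hr (le_max_left _ _) (min_le_left _ _)).trans h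
    · exact (coneNbhd_ray_anti hX ξ hs (le_max_right _ _) (min_le_right _ _)).trans h'
  | sUnion S _ ih =>
    obtain ⟨V, hVS, hV⟩ := hξ
    obtain ⟨r, D, hr, hD, h⟩ := ih V hVS hV
    exact ⟨r, D, hr, hD, h.trans (subset_sUnion_of_mem hVS)⟩

theorem continuous_ray_apply {q : X} {r : ℝ≥0} (hr : 0 < r) :
    Continuous fun ξ : VisualBoundary q => ξ.ray r := by
  rw [continuous_iff_continuousAt]
  intro ξ
  rw [ContinuousAt, Metric.tendsto_nhds]
  intro ε hε
  have hopen : IsOpen (Bordification.ideal ⁻¹' coneNbhd q (ξ.ray r) r ε) :=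
    (isOpen_coneNbhd_ray ξ hr hε).preimage continuous_induced_dom
  filter_upwards [hopen.mem_nhds (show ξ ∈ _ by
    rw [mem_preimage, ideal_mem_coneNbhd, dist_self]; exact hε)] with η hη
  exact hη

/-! ### Paths inside cone neighbourhoods. -/

theorem IsCAT0.joinedIn_of_between (hX : IsCAT0 X) {x y : X} {W : Set X}
    (h : ∀ z, dist x z + dist z y = dist x y → z ∈ W) : JoinedIn W x y := by
  obtain ⟨c, hc0, hc1, hc⟩ := hX.exists_geodesic x y
  have h0 : (0 : ℝ) ∈ Icc 0 (dist x y) := ⟨le_rfl, dist_nonneg⟩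
  have hl : dist x y ∈ Icc 0 (dist x y) := ⟨dist_nonneg, le_rfl⟩
  have hcont : ContinuousOn c (Icc 0 (dist x y)) := by
    refine LipschitzOnWith.continuousOn (K := 1) (LipschitzOnWith.of_dist_le_mul ?_)
    intro s hs t ht
    rw [hc s hs t ht, Real.dist_eq, NNReal.coe_one, one_mul]
  have hpc := ((convex_Icc 0 (dist x y)).isPathConnected ⟨0, h0⟩).image' hcont
  have hj := hpc.joinedIn x ⟨0, h0, hc0⟩ y ⟨_, hl, hc1⟩
  refine hj.mono ?_
  rintro _ ⟨t, ht, rfl⟩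
  apply h
  have e1 := hc 0 h0 t ht
  have e2 := hc t ht _ hl
  rw [hc0, zero_sub, abs_neg, abs_of_nonneg ht.1] at e1
  rw [hc1, abs_sub_comm, abs_of_nonneg (by linarith [ht.2])] at e2
  linarith

/-- Every point of `U(ξ, r + D, D)` can be joined to `ξ(r + D)` inside `U(ξ, r, D)`. -/
theorem joinedIn_coneNbhd (hX : IsCAT0 X) {q a : X} (ξ : VisualBoundary q) {r D : ℝ≥0}
    (hr : 0 < r) (ha : Bordification.point a ∈ coneNbhd q (ξ.ray (r + D)) (r + D) D) :
    JoinedIn {x | Bordification.point x ∈ coneNbhd q (ξ.ray r) r D} a (ξ.ray (r + D)) := by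
  have hle : r ≤ r + D := le_self_add
  rw [point_mem_coneNbhd hX] at ha
  obtain ⟨hqa, p, hp, hpD⟩ := ha
  rw [NNReal.coe_add] at hqa
  have hqp := hp.1
  rw [NNReal.coe_add] at hqp
  have hDpos : (0 : ℝ) < D := dist_nonneg.trans_lt hpD
  refine (hX.joinedIn_of_between (y := p) fun z hz => ?_).trans
    (hX.joinedIn_of_between fun z hz => ?_)
  · rw [mem_ofPred_eq]
    -- Points between `a` and its projection `p` still project to `p`.
    have hz' : IsRadialPoint q (r + D : ℝ≥0) z p := by
      refine ⟨hp.1, le_antisymm ?_ (dist_triangle _ _ _)⟩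
      have := hp.2
      linarith [dist_triangle q z a, dist_comm z p, dist_comm z a, dist_comm p a]
    have := hz'.2
    obtain ⟨m, hm⟩ := hX.exists_isRadialPoint (q := q) (x := p) r.coe_nonneg (by rw [hqp]; linarith)
    rw [point_mem_coneNbhd hX]
    refine ⟨by linarith [dist_nonneg (x := p) (y := z)], m, hm.trans hz', ?_⟩
    exact (hX.dist_radial_le hr hm (ξ.isRadialPoint_ray hle)).trans_lt hpD
  · rw [mem_ofPred_eq]
    have h1 := ξ.dist_ray (r + D)
    rw [NNReal.coe_add] at h1
    have hzD : dist z (ξ.ray (r + D)) < D := by linarith [dist_nonneg (x := p) (y := z)]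
    -- The extra radius `D` keeps this segment, shorter than `D`, outside the `r`-ball.
    have hqz : (r : ℝ) < dist q z := by linarith [dist_triangle q z (ξ.ray (r + D))]
    obtain ⟨m, hm⟩ := hX.exists_isRadialPoint r.coe_nonneg hqz.le
    rw [point_mem_coneNbhd hX]
    exact ⟨hqz, m, hm, (hX.dist_radial_le hr hm (ξ.isRadialPoint_ray hle)).trans_lt hzD⟩

/-- A path at infinity avoiding `Λ(C)` stays uniformly away from `C` in the cone topology. -/
theorem exists_uniform_coneNbhd (hX : IsCAT0 X) {q : X} {C : Set X} {ξ η : VisualBoundary q}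
    (γ : Path ξ η) (hγ : ∀ t, γ t ∉ limitSet q C) :
    ∃ r D : ℝ≥0, 0 < r ∧ 0 < D ∧
      ∀ t, ∀ x ∈ C, Bordification.point x ∉ coneNbhd q ((γ t).ray r) r D := by
  have key : ∃ r D : ℝ≥0, 0 < r ∧ 0 < D ∧ ∀ t ∈ (univ : Set unitInterval), ∀ x ∈ C,
      Bordification.point x ∉ coneNbhd q ((γ t).ray r) r D := by
    refine isCompact_univ.induction_on (p := fun S : Set unitInterval =>
      ∃ r D : ℝ≥0, 0 < r ∧ 0 < D ∧
        ∀ t ∈ S, ∀ x ∈ C, Bordification.point x ∉ coneNbhd q ((γ t).ray r) r D) ?_ ?_ ?_ ?_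
    · exact ⟨1, 1, one_pos, one_pos, by simp⟩
    · rintro S T hST ⟨r, D, hr, hD, h⟩
      exact ⟨r, D, hr, hD, fun t ht => h t (hST ht)⟩
    · rintro S T ⟨r, D, hr, hD, h⟩ ⟨s, E, hs, hE, h'⟩
      refine ⟨max r s, min D E, lt_max_of_lt_left hr, lt_min hD hE, ?_⟩
      rintro t (ht | ht) x hx hmem
      · exact h t ht x hx (coneNbhd_ray_anti hX _ hr (le_max_left _ _)
          (NNReal.coe_le_coe.2 (min_le_left _ _)) hmem)
      · exact h' t ht x hx (coneNbhd_ray_anti hX _ hs (le_max_right _ _)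
          (NNReal.coe_le_coe.2 (min_le_right _ _)) hmem)
    · intro t _
      obtain ⟨r, D, hr, hD, h⟩ := exists_coneNbhd_subset hX (γ t)
        isClosed_closure.isOpen_compl (hγ t)
      have hc : Continuous fun s => (γ s).ray r := (continuous_ray_apply hr).comp γ.continuous
      -- Half of `D` is spent on moving the centre from `γ t` to `γ s`, with `r` fixed.
      refine ⟨_, mem_nhdsWithin_of_mem_nhds
        (hc.continuousAt.eventually (Metric.ball_mem_nhds _ (half_pos hD))), r,
        NNReal.mk (D / 2) (half_pos hD).le, hr, half_pos hD, fun s hs x hx hmem => ?_⟩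
      have hs' : dist ((γ s).ray r) ((γ t).ray r) < D / 2 := hs
      refine h (coneNbhd_subset_of_dist ?_ hmem) (subset_closure ⟨x, hx, rfl⟩)
      rw [NNReal.coe_mk]
      linarith
  simpa using key

end CAT0

/-! ### The separation argument. -/

theorem lemma3p1 {X : Type*} [MetricSpace X] (hX : IsCAT0 X) (q : X)
    (A B C : Set X) (hA : IsClosed A) (hB : IsClosed B) (hC : IsClosed C)
    (hsep : Separates C A B) :
    Separates (limitSet q C) (limitSet q A) (limitSet q B) := by
  intro ξ hξ η hη γ
  by_contra! hγ
  obtain ⟨r, D, hr, hD, hdisj⟩ := exists_uniform_coneNbhd hX γ hγ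
  have hrD : 0 < r + D := add_pos hr hD
  set W : Set X := {x | ∃ t, Bordification.point x ∈ coneNbhd q ((γ t).ray r) r D} with hW
  have near : ∀ (t : unitInterval) (S : Set X), γ t ∈ limitSet q S →
      ∃ a ∈ S, JoinedIn W a ((γ t).ray (r + D)) := by
    intro t S ht
    obtain ⟨_, hU, a, ha, rfl⟩ := mem_closure_iff.1 ht _
      (isOpen_coneNbhd_ray (γ t) hrD (NNReal.coe_pos.2 hD))
      (by rw [ideal_mem_coneNbhd, dist_self]; exact hD)
    exact ⟨a, ha, (joinedIn_coneNbhd hX (γ t) hr hU).mono fun x hx => ⟨t, hx⟩⟩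
  obtain ⟨a, ha, hja⟩ := near 0 A (by rwa [γ.source])
  obtain ⟨b, hb, hjb⟩ := near 1 B (by rwa [γ.target])
  have hc : Continuous fun s => (γ s).ray (r + D) :=
    (continuous_ray_apply hrD).comp γ.continuous
  have hmid : JoinedIn W ((γ 0).ray (r + D)) ((γ 1).ray (r + D)) := by
    refine ⟨⟨⟨fun s => (γ s).ray (r + D), hc⟩, rfl, rfl⟩, fun t => ⟨t, ?_⟩⟩
    change Bordification.point ((γ t).ray (r + D)) ∈ _
    rw [point_mem_coneNbhd hX, VisualBoundary.dist_ray]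
    refine ⟨NNReal.coe_lt_coe.2 (lt_add_of_pos_right r hD), _,
      (γ t).isRadialPoint_ray le_self_add, ?_⟩
    rw [dist_self]
    exact hD
  obtain ⟨δ, hδ⟩ := (hja.trans hmid).trans hjb.symm
  obtain ⟨t, ht⟩ := hsep a ha b hb δ
  obtain ⟨s, hs⟩ := hδ t
  exact hdisj s _ ht hs
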